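/- Let $S=(S_{ij})\in\mathbb R^{p\times p}$ be symmetric with positive diagonal entries (for instance a sample covariance matrix with no zero diagonal entry), and let $\Lambda=(\Lambda_{ij})\in\mathbb R^{p\times p}$ be symmetric with $\Lambda_{ij}\ge 0$ and $\Lambda_{ii}=0$. Assume $S_{ij}<\sqrt{S_{ii}S_{jj}}$ for all $i\neq j$. For a finite index set $U$, let $\mathcal M^{U}$ be the set of real symmetric positive definite matrices $\Theta$ indexed by $U$ with $\Theta_{ij}\le 0$ for all $i\ne j$. Consider the $\mathrm{MTP}_2$-constrained graphical lasso $$\min_{\Theta\in\mathcal M^{\{1,\dots,p\}}}\; -\log\det\Theta+\langle\Theta,S\rangle+\sum_{i\ne j}\Lambda_{ij}|\Theta_{ij}|. \tag{P}$$ Let $T_{ij}=S_{ij}-\Lambda_{ij}$ if $i\neq j$ and $S_{ij}>\Lambda_{ij}$, and $T_{ij}=0$ otherwise. Let $G=\mathrm{supp}(T)$ be the graph on $\{1,\dots,p\}$ in which distinct $i,j$ are adjacent if and only if $T_{ij}\ne0$, let $\mathcal B$ be the set of (ordered) pairs $(i,j)$ such that $\{i,j\}$ is a bridge of $G$ (an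 edge whose deletion increases the number of connected components), and let $\mathcal V_1,\dots,\mathcal V_K$ be the vertex sets of the connected components of the graph obtained from $G$ by deleting all bridges (the bridge-block decomposition of $G$). Then for each $k$ the sub-problem $$\min_{\Theta_k\in\mathcal M^{\mathcal V_k}}\; -\log\det\Theta_k+\langle\Theta_k,\,S_{\mathcal V_k}-\Lambda_{\mathcal V_k}\rangle,$$ where $S_{\mathcal V_k},\Lambda_{\mathcal V_k}$ are the principal submatrices indexed by $\mathcal V_k$, has a unique minimizer $\widehat\Theta_k$; problem (P) has a unique minimizer $\Theta^\star$; and, indexing the entries of $\widehat\Theta_k$ by the elements of $\mathcal V_k$, $$\Theta^\star_{ij}=\begin{cases}[\widehat\Theta_k]_{ii}+\zeta_i & \text{if } i=j\in\mathcal V_k,\\ [\widehat\Theta_k]_{ij} & \text{if } i\ne j \text{ and } i,j\in\mathcal V_k,\\ -\dfrac{T_{ij}}{S_{ii}S_{jj}-T_{ij}^2} & \text{if } (i,j)\in\mathcal B,\\ 0 & \text{otherwise,}\end{cases}\qquad \zeta_i=\frac1{S_{ii}}\sum_{m:\,(i,m)\in\mathcal B}\frac{T_{im}^2}{S_{ii}S_{mm}-T_{im}^2},$$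 where an empty sum is $0$. -/

import Mathlib

namespace MTP2

noncomputable section

/-- Symmetric positive definite matrices whose off-diagonal entries are nonpositive
(symmetry is part of `Matrix.PosDef`). -/
def MMatrices (ι : Type*) [Fintype ι] : Set (Matrix ι ι ℝ) :=
  {Θ | Θ.PosDef ∧ ∀ i j, i ≠ j → Θ i j ≤ 0}

/-- The entrywise (trace) inner product `⟨A, B⟩`. -/
def frobInner {ι : Type*} [Fintype ι] (A B : Matrix ι ι ℝ) : ℝ :=
  ∑ i, ∑ j, A i j * B i j

/-- Objective of the graphical lasso: the negative log-likelihood with a weighted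
off-diagonal `ℓ₁` penalty. -/
def glassoObjective {ι : Type*} [Fintype ι] [DecidableEq ι] (S Λ Θ : Matrix ι ι ℝ) : ℝ :=
  -Real.log Θ.det + frobInner Θ S + ∑ i, ∑ j, if i ≠ j then Λ i j * |Θ i j| else 0

/-- `Θ` is an optimal solution of the MTP₂-constrained graphical lasso. -/
def IsOptimal {ι : Type*} [Fintype ι] [DecidableEq ι] (S Λ Θ : Matrix ι ι ℝ) : Prop :=
  Θ ∈ MMatrices ι ∧ IsMinOn (glassoObjective S Λ) (MMatrices ι) Θ

/-- The thresholded sample covariance matrix `T`. -/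
def thresholded {ι : Type*} [DecidableEq ι] (S Λ : Matrix ι ι ℝ) : Matrix ι ι ℝ :=
  Matrix.of fun i j => if i ≠ j ∧ Λ i j < S i j then S i j - Λ i j else 0

/-- The support graph of a symmetric matrix: distinct `i`, `j` are adjacent iff `A i j ≠ 0`. -/
def suppGraph {ι : Type*} (A : Matrix ι ι ℝ) : SimpleGraph ι :=
  SimpleGraph.fromRel fun i j => A i j ≠ 0

/-- The thresholded graph `supp T`. -/
def thresholdedGraph {ι : Type*} [DecidableEq ι] (S Λ : Matrix ι ι ℝ) : SimpleGraph ι :=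
  suppGraph (thresholded S Λ)

/-- The index set of the bridge-block decomposition of `G`: the connected components of the
graph obtained from `G` by deleting all of its bridges. The `k`-th cluster is `k.supp`. -/
abbrev Cluster {ι : Type*} (G : SimpleGraph ι) : Type _ :=
  (G.deleteEdges {e | e ∈ G.edgeSet ∧ G.IsBridge e}).ConnectedComponent

/-- Objective of a sub-problem on a vertex set `U`, with the principal submatrices
`S_U` and `Λ_U`. -/
def subObjective {ι : Type*} (S Λ : Matrix ι ι ℝ) (U : Set ι) [Fintype U] [DecidableEq U]
    (Θ : Matrix U U ℝ) : ℝ :=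
  -Real.log Θ.det +
    frobInner Θ (S.submatrix Subtype.val Subtype.val - Λ.submatrix Subtype.val Subtype.val)

open Classical in
/-- `Θ` is an optimal solution of the sub-problem on the vertex set `U`. -/
def IsSubOptimal {ι : Type*} [Fintype ι] (S Λ : Matrix ι ι ℝ) (U : Set ι)
    (Θ : Matrix U U ℝ) : Prop :=
  Θ ∈ MMatrices U ∧ IsMinOn (subObjective S Λ U) (MMatrices U) Θ

/-- `(i, j)` is a bridge of the thresholded graph. -/
def Bridge {ι : Type*} [DecidableEq ι] (S Λ : Matrix ι ι ℝ) (i j : ι) : Prop :=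
  (thresholdedGraph S Λ).Adj i j ∧ (thresholdedGraph S Λ).IsBridge s(i, j)

open Classical in
/-- The diagonal correction `ζ i` (an empty sum is `0`). -/
def zeta {ι : Type*} [Fintype ι] [DecidableEq ι] (S Λ : Matrix ι ι ℝ) (i : ι) : ℝ :=
  1 / S i i * ∑ m with Bridge S Λ i m,
    thresholded S Λ i m ^ 2 / (S i i * S m m - thresholded S Λ i m ^ 2)

end

end MTP2

/-!
On M-matrices the `ℓ₁` penalty is linear, so the penalized problem and all sub-problems minimize
`-log det Θ + ⟨Θ, C⟩` over M-matrices, with `C = S - Λ` or a principal submatrix of it. Everything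
rests on the optimality conditions `IsKKT`: with `W = Θ⁻¹`, the matrices `W` and `C` agree on the
diagonal and wherever `Θ` is nonzero, and `C ≤ W` elsewhere. By the tangent inequality for `log det`
and its equality case (`log_det_le_tangent`) these conditions characterize the minimizer and make it
unique (`IsKKT.isMinOn`, `isKKT_of_isMinOn`). A minimizer exists because the bound
`C i j < √(C i i * C j j)` makes `⟨Θ, C⟩` dominate a multiple of the trace of `Θ`
(`exists_isMinOn_detObjective`).

It remains to exhibit the inverse `W` of the claimed optimum. Start from the block diagonal matrix of
the inverses of the cluster solutions and add the bridges one at a time. When a bridge `{a, b}` with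
covariance `t` is added, `a` and `b` are still uncorrelated, and the covariance `W` becomes
`W + t / (W a a * W b b) * (W e_a e_bᵀ W + W e_b e_aᵀ W)`, while the precision matrix changes only in
the rows and columns `a`, `b`, by `edgeCorrection` (`add_edgeCorrection_mul_joinCovariance`). Positive
definiteness survives by Bessel's inequality (`posDef_joinCovariance`), and since `{a, b}` is a
bridge, covariances between already connected vertices do not change
(`exists_covariance_of_bridges`). The final `W` restricts to the cluster covariances, equals `S - Λ`
on bridges, and is entrywise nonnegative because inverses of M-matrices are
(`inv_nonneg_of_mem_MMatrices`). A pair that is neither a bridge nor inside a cluster is not an edge,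
so there `S - Λ ≤ 0 ≤ W`. Hence the optimality conditions hold.
-/

namespace MTP2

open Matrix Filter Topology

variable {ι V : Type*} [Fintype ι] [DecidableEq ι] [Fintype V] [DecidableEq V]

/-! ### The logarithm of the determinant -/

lemma exists_conjTranspose_mul_self_eq {A : Matrix ι ι ℝ} (hA : A.PosDef) :
    ∃ R : Matrix ι ι ℝ, IsUnit R ∧ A = Rᴴ * R := by
  open scoped MatrixOrder in
  obtain ⟨R, hR⟩ := CStarAlgebra.nonneg_iff_eq_star_mul_self.mp hA.posSemidef.nonneg
  refine ⟨R, ?_, hR⟩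
  have hd : A.det ≠ 0 := hA.det_pos.ne'
  rw [hR, det_mul] at hd
  exact (isUnit_iff_isUnit_det _).2 (right_ne_zero_of_mul hd).isUnit

lemma log_det_le_trace_sub_card {A : Matrix ι ι ℝ} (hA : A.PosDef) :
    Real.log A.det ≤ A.trace - Fintype.card ι ∧
      (Real.log A.det = A.trace - Fintype.card ι → A = 1) := by
  have hpos := hA.eigenvalues_pos
  have hdet : Real.log A.det = ∑ i, Real.log (hA.isHermitian.eigenvalues i) := by
    rw [hA.isHermitian.det_eq_prod_eigenvalues, ← Real.log_prod]
    · simp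
    · exact fun i _ ↦ (hpos i).ne'
  have htr : A.trace - Fintype.card ι = ∑ i, (hA.isHermitian.eigenvalues i - 1) := by
    rw [hA.isHermitian.trace_eq_sum_eigenvalues]
    simp
  have hle : ∀ i ∈ Finset.univ, Real.log (hA.isHermitian.eigenvalues i) ≤
      hA.isHermitian.eigenvalues i - 1 := fun i _ ↦ Real.log_le_sub_one_of_pos (hpos i)
  rw [hdet, htr]
  refine ⟨Finset.sum_le_sum hle, fun h ↦ ?_⟩
  rw [Finset.sum_eq_sum_iff_of_le hle] at h
  have h1 : hA.isHermitian.eigenvalues = 1 := by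
    ext i
    by_contra hne
    exact (Real.log_lt_sub_one_of_pos (hpos i) hne).ne (h i (Finset.mem_univ i))
  rw [hA.isHermitian.spectral_theorem, h1]
  have : diagonal (RCLike.ofReal ∘ (1 : ι → ℝ) : ι → ℝ) = 1 := by
    ext i j; simp [diagonal, one_apply]
  rw [this, map_one]

/-- The tangent inequality for the strictly concave function `log det` at `B`, together with its
equality case. -/
lemma log_det_le_tangent {A B W : Matrix ι ι ℝ} (hA : A.PosDef) (hB : B.PosDef)
    (hW : B * W = 1) :
    Real.log A.det ≤ Real.log B.det + ((A * W).trace - Fintype.card ι) ∧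
      (Real.log A.det = Real.log B.det + ((A * W).trace - Fintype.card ι) → A = B) := by
  have hWB : W * B = 1 := mul_eq_one_comm.1 hW
  have hWinv : B⁻¹ = W := inv_eq_right_inv hW
  obtain ⟨R, hR, hWR⟩ := exists_conjTranspose_mul_self_eq (hWinv ▸ hB.inv : W.PosDef)
  have hinj : Function.Injective R.vecMul := vecMul_injective_of_isUnit hR
  have hM := hA.mul_mul_conjTranspose_same hinj
  have htr : (R * A * Rᴴ).trace = (A * W).trace := by
    rw [trace_mul_cycle, hWR, trace_mul_comm]
  have hdet : Real.log (R * A * Rᴴ).det = Real.log A.det - Real.log B.det := by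
    have h1 : (R * A * Rᴴ).det = A.det * W.det := by
      rw [hWR]; simp only [det_mul]; ring
    have h2 : B.det * W.det = 1 := by rw [← det_mul, hW, det_one]
    have h3 : W.det = B.det⁻¹ := eq_inv_of_mul_eq_one_right h2
    rw [h1, h3, Real.log_mul hA.det_pos.ne' (inv_ne_zero hB.det_pos.ne'), Real.log_inv]; ring
  obtain ⟨h1, h2⟩ := log_det_le_trace_sub_card hM
  rw [htr, hdet] at h1 h2
  refine ⟨by linarith, fun h ↦ ?_⟩
  have h3 := h2 (by linarith)
  obtain ⟨r, rfl⟩ := hR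
  have h4 : A * W = 1 := by
    have : (r : Matrix ι ι ℝ) * (A * (r : Matrix ι ι ℝ)ᴴ) = 1 := by rw [← mul_assoc, h3]
    rwa [mul_eq_one_comm, mul_assoc, ← hWR] at this
  calc A = A * (W * B) := by rw [hWB, mul_one]
    _ = B := by rw [← mul_assoc, h4, one_mul]

/-- Small symmetric perturbations of a positive definite matrix are positive definite. -/
lemma eventually_posDef_add_smul {A H : Matrix ι ι ℝ} (hA : A.PosDef) (hH : H.IsHermitian) :
    ∀ᶠ t : ℝ in 𝓝[>] 0, (A + t • H).PosDef := by
  obtain ⟨R, ⟨r, rfl⟩, hR⟩ := exists_conjTranspose_mul_self_eq hA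
  set K : Matrix ι ι ℝ := (↑r⁻¹ : Matrix ι ι ℝ)ᴴ * H * (↑r⁻¹ : Matrix ι ι ℝ) with hK
  have hKh : K.IsHermitian := isHermitian_conjTranspose_mul_mul _ hH
  set κ : ℝ := ∑ i, ∑ j, |K i j| with hκ
  have hκ0 : 0 ≤ κ := by positivity
  have hquad : ∀ x : ι → ℝ, |x ⬝ᵥ (K *ᵥ x)| ≤ κ * (x ⬝ᵥ x) := by
    intro x
    have hi : ∀ i, x i ^ 2 ≤ x ⬝ᵥ x := fun i ↦ by
      rw [sq]
      exact Finset.single_le_sum (f := fun i ↦ x i * x i)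
        (fun j _ ↦ mul_self_nonneg _) (Finset.mem_univ i)
    calc |x ⬝ᵥ (K *ᵥ x)| = |∑ i, ∑ j, K i j * (x i * x j)| := by
          simp only [dotProduct, mulVec, Finset.mul_sum]
          congr 1
          exact Finset.sum_congr rfl fun i _ ↦ Finset.sum_congr rfl fun j _ ↦ by ring
      _ ≤ ∑ i, ∑ j, |K i j| * (x ⬝ᵥ x) := by
          refine (Finset.abs_sum_le_sum_abs _ _).trans (Finset.sum_le_sum fun i _ ↦ ?_)
          refine (Finset.abs_sum_le_sum_abs _ _).trans (Finset.sum_le_sum fun j _ ↦ ?_)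
          rw [abs_mul]
          refine mul_le_mul_of_nonneg_left ?_ (abs_nonneg _)
          rw [abs_le]
          constructor <;> nlinarith [hi i, hi j, sq_nonneg (x i + x j), sq_nonneg (x i - x j)]
      _ = κ * (x ⬝ᵥ x) := by simp only [hκ, Finset.sum_mul]
  have hev : ∀ᶠ t : ℝ in 𝓝[>] 0, t * κ < 1 := by
    have : Tendsto (fun t : ℝ ↦ t * κ) (𝓝[>] 0) (𝓝 (0 * κ)) :=
      (tendsto_id.mul_const κ).mono_left nhdsWithin_le_nhds
    rw [zero_mul] at this
    exact this.eventually_lt_const one_pos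
  filter_upwards [hev, self_mem_nhdsWithin] with t ht ht0
  have ht0 : 0 < t := ht0
  have h1 : (1 + t • K).PosDef := by
    refine .of_dotProduct_mulVec_pos (isHermitian_one.add ?_) fun x hx ↦ ?_
    · rw [IsHermitian, conjTranspose_smul, hKh.eq, star_trivial]
    · have hxx : 0 < x ⬝ᵥ x := by
        simpa using dotProduct_star_self_pos_iff.2 hx
      rw [star_trivial, add_mulVec, one_mulVec, smul_mulVec, dotProduct_add, dotProduct_smul,
        smul_eq_mul]
      have := (abs_le.1 (hquad x)).1
      nlinarith
  have h2 := h1.conjTranspose_mul_mul_same (B := (r : Matrix ι ι ℝ))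
    (mulVec_injective_of_isUnit r.isUnit)
  convert h2 using 1
  rw [mul_add, add_mul, mul_one, ← hR, Matrix.mul_smul, Matrix.smul_mul, hK]
  congr 2
  have e1 : (r : Matrix ι ι ℝ)ᴴ * (↑r⁻¹ : Matrix ι ι ℝ)ᴴ = 1 := by
    rw [← conjTranspose_mul]; simp
  have e2 : (↑r⁻¹ : Matrix ι ι ℝ) * (r : Matrix ι ι ℝ) = 1 := by simp
  rw [← mul_assoc, ← mul_assoc, e1, one_mul, mul_assoc, e2, mul_one]

/-! ### Optimality conditions for the log-determinant objective -/

/-- The objective `-log det Θ + ⟨Θ, C⟩`, the common form on M-matrices of the penalized problem and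
of the sub-problems. -/
noncomputable def detObjective (C Θ : Matrix ι ι ℝ) : ℝ :=
  -Real.log Θ.det + frobInner Θ C

/-- The Karush-Kuhn-Tucker conditions for minimizing `detObjective C` over the M-matrices, where `W`
is the inverse of the candidate `Θ`. -/
structure IsKKT (C Θ W : Matrix ι ι ℝ) : Prop where
  mul_eq_one : Θ * W = 1
  diag_eq : ∀ i, W i i = C i i
  le : ∀ i j, i ≠ j → C i j ≤ W i j
  eq_of_ne_zero : ∀ i j, i ≠ j → Θ i j ≠ 0 → W i j = C i j

lemma detObjective_tangent {A B W : Matrix ι ι ℝ} (C : Matrix ι ι ℝ) (hA : A.PosDef)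
    (hB : B.PosDef) (hW : B * W = 1) :
    detObjective C B + frobInner (A - B) (C - W) ≤ detObjective C A ∧
      (detObjective C B + frobInner (A - B) (C - W) = detObjective C A → A = B) := by
  have hWs : ∀ i j, W i j = W j i := by
    have : W.IsHermitian := by rw [← inv_eq_right_inv hW]; exact hB.isHermitian.inv
    exact fun i j ↦ by simpa using this.apply j i
  have htr (M : Matrix ι ι ℝ) : (M * W).trace = frobInner M W := by
    simp only [trace, diag, mul_apply, frobInner]
    exact Finset.sum_congr rfl fun i _ ↦ Finset.sum_congr rfl fun j _ ↦ by rw [hWs j i]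
  have hBW : frobInner B W = Fintype.card ι := by rw [← htr, hW, trace_one]
  have hexp : frobInner (A - B) (C - W) =
      frobInner A C - frobInner B C - (A * W).trace + Fintype.card ι := by
    rw [htr, ← hBW]
    simp only [frobInner, ← Finset.sum_sub_distrib, ← Finset.sum_add_distrib, Matrix.sub_apply]
    exact Finset.sum_congr rfl fun i _ ↦ Finset.sum_congr rfl fun j _ ↦ by ring
  obtain ⟨h1, h2⟩ := log_det_le_tangent hA hB hW
  rw [hexp]
  unfold detObjective
  exact ⟨by linarith, fun h ↦ h2 (by linarith)⟩

/-- By convexity the optimality conditions are sufficient, and they single out the minimizer. -/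
lemma IsKKT.isMinOn {C Θ W : Matrix ι ι ℝ} (h : IsKKT C Θ W) (hΘ : Θ ∈ MMatrices ι) :
    IsMinOn (detObjective C) (MMatrices ι) Θ ∧
      ∀ Θ' ∈ MMatrices ι, IsMinOn (detObjective C) (MMatrices ι) Θ' → Θ' = Θ := by
  have key : ∀ A ∈ MMatrices ι, 0 ≤ frobInner (A - Θ) (C - W) := fun A hA ↦ by
    refine Finset.sum_nonneg fun i _ ↦ Finset.sum_nonneg fun j _ ↦ ?_
    simp only [Matrix.sub_apply]
    rcases eq_or_ne i j with rfl | hij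
    · simp [h.diag_eq]
    · have h1 := h.le i j hij
      have h2 := hA.2 i j hij
      rcases eq_or_ne (Θ i j) 0 with h0 | h0
      · rw [h0]; nlinarith
      · rw [h.eq_of_ne_zero i j hij h0]; simp
  refine ⟨fun A hA ↦ ?_, fun A hA hmin ↦ ?_⟩
  · have := (detObjective_tangent C hA.1 hΘ.1 h.mul_eq_one).1
    have := key A hA
    simp only [Set.mem_ofPred_eq]; linarith
  · obtain ⟨h1, h2⟩ := detObjective_tangent C hA.1 hΘ.1 h.mul_eq_one
    have h3 := key A hA
    have h4 : detObjective C A ≤ detObjective C Θ := hmin hΘ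
    exact h2 (by linarith)

lemma frobInner_single (i j : ι) (c : ℝ) (B : Matrix ι ι ℝ) :
    frobInner (single i j c) B = c * B i j := by
  unfold frobInner
  rw [Finset.sum_eq_single i, Finset.sum_eq_single j]
  · simp
  · intro b _ hb; simp [hb.symm]
  · simp
  · intro b _ hb; simp [hb.symm]
  · simp

omit [DecidableEq ι] in
lemma frobInner_add_left (A B C : Matrix ι ι ℝ) :
    frobInner (A + B) C = frobInner A C + frobInner B C := by
  simp [frobInner, add_mul, Finset.sum_add_distrib]

/-- First-order condition at a minimizer in a feasible direction `H`. -/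
lemma frobInner_nonneg_of_isMinOn {C Θ H : Matrix ι ι ℝ} (hΘ : Θ ∈ MMatrices ι)
    (hmin : IsMinOn (detObjective C) (MMatrices ι) Θ) (hH : H.IsHermitian)
    (hfeas : ∀ i j, i ≠ j → ∀ᶠ t : ℝ in 𝓝[>] 0, Θ i j + t * H i j ≤ 0) :
    0 ≤ frobInner H (C - Θ⁻¹) := by
  have hcont : Tendsto (fun t : ℝ ↦ frobInner H (C - (Θ + t • H)⁻¹)) (𝓝[>] 0)
      (𝓝 (frobInner H (C - Θ⁻¹))) := by
    have h1 : Tendsto (fun t : ℝ ↦ Θ + t • H) (𝓝[>] 0) (𝓝 Θ) := by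
      have h : Continuous fun t : ℝ ↦ Θ + t • H := by fun_prop
      simpa using (h.tendsto 0).mono_left nhdsWithin_le_nhds
    have h2 : ContinuousAt (fun M : Matrix ι ι ℝ ↦ frobInner H (C - M⁻¹)) Θ := by
      have h3 : ContinuousAt (fun M : Matrix ι ι ℝ ↦ M⁻¹) Θ := by
        simp only [inv_def, Ring.inverse_eq_inv']
        have hd : ContinuousAt (fun M : Matrix ι ι ℝ ↦ M.det) Θ :=
          (continuous_id.matrix_det).continuousAt
        exact (hd.inv₀ hΘ.1.det_pos.ne').smul (continuous_id.matrix_adjugate).continuousAt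
      have h4 : Continuous fun M : Matrix ι ι ℝ ↦ frobInner H (C - M) := by
        unfold frobInner
        simp only [Matrix.sub_apply]
        fun_prop
      exact h4.continuousAt.comp h3
    exact h2.tendsto.comp h1
  refine ge_of_tendsto hcont ?_
  have hfeas' : ∀ᶠ t : ℝ in 𝓝[>] 0, ∀ i j, i ≠ j → Θ i j + t * H i j ≤ 0 := by
    simp only [eventually_all]
    exact hfeas
  filter_upwards [hfeas', eventually_posDef_add_smul hΘ.1 hH, self_mem_nhdsWithin]
    with t h1 h2 h3
  have h3 : 0 < t := h3
  have hmem : Θ + t • H ∈ MMatrices ι := ⟨h2, fun i j hij ↦ by simpa using h1 i j hij⟩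
  have h4 : detObjective C Θ ≤ detObjective C (Θ + t • H) := hmin hmem
  -- The tangent inequality is used at the perturbed point, so that no derivative is needed.
  have h5 := (detObjective_tangent C hΘ.1 h2
    (mul_nonsing_inv _ (isUnit_iff_ne_zero.2 h2.det_pos.ne'))).1
  have h6 : frobInner (Θ - (Θ + t • H)) (C - (Θ + t • H)⁻¹) =
      -t * frobInner H (C - (Θ + t • H)⁻¹) := by
    simp only [frobInner, Finset.mul_sum, sub_add_cancel_left, Matrix.neg_apply,
      Matrix.smul_apply, smul_eq_mul]
    exact Finset.sum_congr rfl fun i _ ↦ Finset.sum_congr rfl fun j _ ↦ by ring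
  rw [h6] at h5
  by_contra hneg
  push Not at hneg
  nlinarith

/-- The optimality conditions hold at every minimizer. -/
lemma isKKT_of_isMinOn {C Θ : Matrix ι ι ℝ} (hC : C.IsSymm) (hΘ : Θ ∈ MMatrices ι)
    (hmin : IsMinOn (detObjective C) (MMatrices ι) Θ) : IsKKT C Θ Θ⁻¹ := by
  have hsymm : ∀ i j, (C - Θ⁻¹) j i = (C - Θ⁻¹) i j := fun i j ↦ by
    have h1 : Θ⁻¹ᴴ = Θ⁻¹ := hΘ.1.isHermitian.inv
    have h2 := congrFun₂ h1 i j
    have h3 := hC.apply i j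
    simp only [conjTranspose_apply, star_trivial] at h2
    simp [h2, h3]
  have hΘs : ∀ i j, Θ j i = Θ i j := fun i j ↦ by simpa using hΘ.1.isHermitian.apply i j
  have hsgl : ∀ (i j : ι) (c : ℝ), (single i j c + single j i c).IsHermitian := fun i j c ↦ by
    rw [IsHermitian, conjTranspose_add, conjTranspose_single, conjTranspose_single, add_comm]
    simp
  -- The one-parameter family of symmetric directions in the entries `(i, j)` and `(j, i)`.
  have key : ∀ (i j : ι) (c : ℝ), (i ≠ j → ∀ᶠ t : ℝ in 𝓝[>] 0, Θ i j + t * c ≤ 0) →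
      0 ≤ c * (C - Θ⁻¹) i j := fun i j c hc ↦ by
    have h := frobInner_nonneg_of_isMinOn hΘ hmin (hsgl i j c) fun k l hkl ↦ ?_
    · rw [frobInner_add_left, frobInner_single, frobInner_single, hsymm i j] at h
      linarith
    · have h0 := hΘ.2 k l hkl
      simp only [Matrix.add_apply, single_apply]
      by_cases h1 : i = k ∧ j = l
      · obtain ⟨rfl, rfl⟩ := h1
        simpa [hkl] using hc hkl
      · by_cases h2 : j = k ∧ i = l
        · obtain ⟨rfl, rfl⟩ := h2
          simpa [hkl, hΘs] using hc hkl.symm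
        · simp [h1, h2, h0]
  refine ⟨mul_nonsing_inv _ (isUnit_iff_ne_zero.2 hΘ.1.det_pos.ne'), fun i ↦ ?_, fun i j hij ↦ ?_,
    fun i j hij h0 ↦ ?_⟩
  · have h1 := key i i 1 (fun h ↦ absurd rfl h)
    have h2 := key i i (-1) (fun h ↦ absurd rfl h)
    simp only [Matrix.sub_apply] at h1 h2
    linarith
  all_goals
    have h1 := key i j (-1) fun _ ↦ by
      filter_upwards [self_mem_nhdsWithin] with t (ht : 0 < t)
      linarith [hΘ.2 i j hij]
    simp only [Matrix.sub_apply] at h1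
  · linarith
  · have h2 := key i j 1 fun _ ↦ by
      have hlt : Θ i j < 0 := lt_of_le_of_ne (hΘ.2 i j hij) h0
      filter_upwards [Ioo_mem_nhdsGT (neg_pos.2 hlt)] with t ht
      linarith [ht.2]
    simp only [Matrix.sub_apply] at h2
    linarith

/-- The inverse of an M-matrix is entrywise nonnegative. -/
lemma inv_nonneg_of_mem_MMatrices {Θ W : Matrix ι ι ℝ} (hΘ : Θ ∈ MMatrices ι) (hW : Θ * W = 1)
    (i j : ι) : 0 ≤ W i j := by
  set x : ι → ℝ := fun k ↦ W k j with hx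
  have hΘx : Θ *ᵥ x = Pi.single j 1 := by
    ext k
    have := congrFun₂ hW k j
    rw [mul_apply] at this
    simpa [mulVec, dotProduct, hx, one_apply, Pi.single_apply] using this
  -- The negative part `y` of the column satisfies `yᵀ Θ y ≤ -yᵀ Θ x ≤ 0`.
  set y : ι → ℝ := fun k ↦ max (-x k) 0 with hy
  have hy0 : ∀ k, 0 ≤ y k := fun k ↦ le_max_right _ _
  have hxy : ∀ k, 0 ≤ x k + y k := fun k ↦ by
    have := le_max_left (-x k) 0
    simp only [hy]; linarith
  have h1 : y ⬝ᵥ (Θ *ᵥ (x + y)) ≤ 0 := by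
    simp only [dotProduct, mulVec, Finset.mul_sum, Pi.add_apply]
    refine Finset.sum_nonpos fun k _ ↦ Finset.sum_nonpos fun l _ ↦ ?_
    rcases eq_or_ne k l with rfl | hkl
    · have : y k * (x k + y k) = 0 := by
        simp only [hy]
        rcases le_total (-x k) 0 with h | h
        · simp [max_eq_right h]
        · simp [max_eq_left h]
      rw [show y k * (Θ k k * (x k + y k)) = Θ k k * (y k * (x k + y k)) by ring, this, mul_zero]
    · exact mul_nonpos_of_nonneg_of_nonpos (hy0 k)
        (mul_nonpos_of_nonpos_of_nonneg (hΘ.2 k l hkl) (hxy l))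
  have h2 : 0 ≤ y ⬝ᵥ (Θ *ᵥ x) := by
    rw [hΘx, dotProduct_single, mul_one]; exact hy0 j
  rw [mulVec_add, dotProduct_add] at h1
  have h3 : y = 0 := by
    by_contra hne
    have := hΘ.1.dotProduct_mulVec_pos hne
    rw [star_trivial] at this
    linarith
  have h4 := hxy i
  rwa [h3, Pi.zero_apply, add_zero] at h4

/-! ### Existence of minimizers -/

omit [DecidableEq ι] in
/-- Off-diagonal dominance of `C` by `√(C i i * C j j)` makes `⟨·, C⟩` control the trace: after a
slight shrinking, `C` is dominated off the diagonal by the rank-one matrix `√(C i i) √(C j j)`. -/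
lemma exists_trace_le_frobInner {C : Matrix ι ι ℝ} (hpos : ∀ i, 0 < C i i)
    (hlt : ∀ i j, i ≠ j → C i j < √(C i i * C j j)) :
    ∃ δ > 0, ∀ Θ ∈ MMatrices ι, δ * Θ.trace ≤ frobInner Θ C := by
  have hε : ∀ᶠ ε : ℝ in 𝓝[>] 0, ∀ i j, i ≠ j → C i j ≤ (1 - ε) * √(C i i * C j j) := by
    simp only [eventually_all]
    intro i j hij
    have h : Tendsto (fun ε : ℝ ↦ (1 - ε) * √(C i i * C j j)) (𝓝[>] 0)
        (𝓝 ((1 - 0) * √(C i i * C j j))) :=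
      ((tendsto_const_nhds.sub tendsto_id).mul_const _).mono_left nhdsWithin_le_nhds
    rw [sub_zero, one_mul] at h
    exact (h.eventually_const_lt (hlt i j hij)).mono fun _ ↦ le_of_lt
  obtain ⟨ε, hε, hε1⟩ := (hε.and (Ioo_mem_nhdsGT one_pos)).exists
  have hδ : ∀ᶠ δ : ℝ in 𝓝[>] 0, ∀ i, δ ≤ ε * C i i := by
    rw [eventually_all]
    exact fun i ↦ Filter.mem_of_superset (Ioo_mem_nhdsGT (mul_pos hε1.1 (hpos i)))
      fun t ht ↦ ht.2.le
  obtain ⟨δ, hδ, hδ0⟩ := (hδ.and self_mem_nhdsWithin).exists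
  refine ⟨δ, hδ0, fun Θ hΘ ↦ ?_⟩
  set v : ι → ℝ := fun i ↦ √(C i i) with hv
  have hquad : 0 ≤ ∑ i, ∑ j, v i * Θ i j * v j := by
    have := hΘ.1.posSemidef.dotProduct_mulVec_nonneg v
    simpa [dotProduct, mulVec, Finset.mul_sum, mul_assoc] using this
  classical
  have hterm : ∀ i j, (1 - ε) * (v i * Θ i j * v j) + (if i = j then δ * Θ i i else 0) ≤
      Θ i j * C i j := by
    intro i j
    split_ifs with hij
    · subst hij
      have h1 : v i * v i = C i i := Real.mul_self_sqrt (hpos i).le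
      have h2 : 0 < Θ i i := hΘ.1.diag_pos
      have h3 := hδ i
      rw [show v i * Θ i i * v i = Θ i i * (v i * v i) by ring, h1]
      nlinarith
    · have h1 : √(C i i * C j j) = v i * v j := Real.sqrt_mul (hpos i).le _
      have h2 := hε i j hij
      have h3 := hΘ.2 i j hij
      rw [h1] at h2
      nlinarith
  calc δ * Θ.trace ≤ (1 - ε) * ∑ i, ∑ j, v i * Θ i j * v j + ∑ i, δ * Θ i i := by
        rw [trace, Finset.mul_sum]
        have := mul_nonneg (sub_nonneg.2 hε1.2.le) hquad
        simp only [diag]; linarith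
    _ = ∑ i, ∑ j, ((1 - ε) * (v i * Θ i j * v j) + if i = j then δ * Θ i i else 0) := by
        simp [Finset.sum_add_distrib, Finset.mul_sum]
    _ ≤ frobInner Θ C := Finset.sum_le_sum fun i _ ↦ Finset.sum_le_sum fun j _ ↦ hterm i j

omit [DecidableEq ι] in
lemma isClosed_posSemidef : IsClosed {Θ : Matrix ι ι ℝ | Θ.PosSemidef} := by
  have : {Θ : Matrix ι ι ℝ | Θ.PosSemidef} =
      {Θ : Matrix ι ι ℝ | Θᴴ = Θ} ∩ ⋂ x : ι → ℝ, {Θ : Matrix ι ι ℝ | 0 ≤ star x ⬝ᵥ (Θ *ᵥ x)} := by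
    ext Θ
    simp [posSemidef_iff_dotProduct_mulVec, IsHermitian]
  rw [this]
  refine (isClosed_eq continuous_id.matrix_conjTranspose continuous_id).inter ?_
  refine isClosed_iInter fun x ↦ isClosed_le continuous_const ?_
  exact continuous_const.dotProduct (continuous_id.matrix_mulVec continuous_const)

lemma abs_apply_le_trace {Θ : Matrix ι ι ℝ} (hΘ : Θ.PosSemidef) (i j : ι) :
    |Θ i j| ≤ Θ.trace := by
  have hle : ∀ i, Θ i i ≤ Θ.trace := fun i ↦
    Finset.single_le_sum (f := fun i ↦ Θ i i) (fun j _ ↦ hΘ.diag_nonneg) (Finset.mem_univ i)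
  have hs : Θ j i = Θ i j := by simpa using hΘ.isHermitian.apply i j
  have key : ∀ c : ℝ, 0 ≤ Θ i i + 2 * c * Θ i j + c ^ 2 * Θ j j := fun c ↦ by
    have := hΘ.dotProduct_mulVec_nonneg (Pi.single i 1 + c • Pi.single j 1)
    simp only [star_trivial, mulVec_add, mulVec_smul, add_dotProduct, dotProduct_add,
      smul_dotProduct, dotProduct_smul, mulVec_single_one, single_dotProduct, smul_eq_mul,
      col_apply, hs, one_mul] at this
    linarith
  have h1 := key 1
  have h2 := key (-1)
  have h3 := hle i
  have h4 := hle j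
  rw [abs_le]
  constructor <;> linarith

/-- The closed cone of positive semidefinite matrices with nonpositive off-diagonal entries, cut
down by a lower bound on the determinant and an upper bound on the trace, is compact. -/
lemma isCompact_posSemidef_det_ge_trace_le (d r : ℝ) :
    IsCompact {Θ : Matrix ι ι ℝ | Θ.PosSemidef ∧ (∀ i j, i ≠ j → Θ i j ≤ 0) ∧
      d ≤ Θ.det ∧ Θ.trace ≤ r} := by
  have hbox : IsCompact (X := Matrix ι ι ℝ)
      (Set.univ.pi fun _ : ι ↦ Set.univ.pi fun _ : ι ↦ Set.Icc (-r) r) :=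
    isCompact_univ_pi fun _ ↦ isCompact_univ_pi fun _ ↦ isCompact_Icc
  have hoff : IsClosed {Θ : Matrix ι ι ℝ | ∀ i j, i ≠ j → Θ i j ≤ 0} := by
    have : {Θ : Matrix ι ι ℝ | ∀ i j, i ≠ j → Θ i j ≤ 0} =
        ⋂ (i : ι) (j : ι) (_ : i ≠ j), {Θ : Matrix ι ι ℝ | Θ i j ≤ 0} := by
      ext Θ; simp
    rw [this]
    exact isClosed_iInter fun i ↦ isClosed_iInter fun j ↦ isClosed_iInter fun _ ↦
      isClosed_le (continuous_id.matrix_elem i j) continuous_const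
  refine hbox.of_isClosed_subset (isClosed_posSemidef.inter (hoff.inter
    ((isClosed_le continuous_const continuous_id.matrix_det).inter
      (isClosed_le continuous_id.matrix_trace continuous_const)))) ?_
  intro Θ hΘ i _ j _
  exact abs_le.1 ((abs_apply_le_trace hΘ.1 i j).trans hΘ.2.2.2)

/-- Existence of a minimizer: sublevel sets have bounded trace, hence determinant bounded away from
zero, hence are compact. -/
lemma exists_isMinOn_detObjective {C : Matrix ι ι ℝ} (hpos : ∀ i, 0 < C i i)
    (hlt : ∀ i j, i ≠ j → C i j < √(C i i * C j j)) :
    ∃ Θ ∈ MMatrices ι, IsMinOn (detObjective C) (MMatrices ι) Θ := by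
  obtain ⟨δ, hδ, hcoer⟩ := exists_trace_le_frobInner hpos hlt
  have hone : (1 : Matrix ι ι ℝ) ∈ MMatrices ι :=
    ⟨.one, fun i j hij ↦ by simp [one_apply_ne hij]⟩
  set c := detObjective C 1 with hc
  set n : ℝ := (Fintype.card ι : ℝ) with hn
  set r : ℝ := (c - n - n * Real.log (δ / 2)) / (δ / 2) with hr
  set K := {Θ : Matrix ι ι ℝ | Θ.PosSemidef ∧ (∀ i j, i ≠ j → Θ i j ≤ 0) ∧
      Real.exp (-c) ≤ Θ.det ∧ Θ.trace ≤ r} with hK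
  have hsub : ∀ Θ ∈ MMatrices ι, detObjective C Θ ≤ c → Θ ∈ K := by
    intro Θ hΘ hle
    have hdet := hΘ.1.det_pos
    have h1 := hcoer Θ hΘ
    have htr : 0 ≤ δ * Θ.trace := mul_nonneg hδ.le hΘ.1.posSemidef.trace_nonneg
    have h2 : (-Real.log Θ.det) + frobInner Θ C ≤ c := hle
    refine ⟨hΘ.1.posSemidef, hΘ.2, ?_, ?_⟩
    · rw [← Real.le_log_iff_exp_le hdet]
      linarith
    · have h3 := (log_det_le_trace_sub_card (hΘ.1.smul (half_pos hδ))).1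
      rw [det_smul, Real.log_mul (by positivity) hdet.ne', Real.log_pow, trace_smul,
        smul_eq_mul] at h3
      rw [hr, le_div_iff₀ (half_pos hδ)]
      linarith
  have hKsub : K ⊆ MMatrices ι := fun Θ hΘ ↦
    ⟨hΘ.1.posDef_iff_det_ne_zero.2 ((Real.exp_pos _).trans_le hΘ.2.2.1).ne', hΘ.2.1⟩
  have hcont : ContinuousOn (detObjective C) K := by
    refine ContinuousOn.add (ContinuousOn.neg (ContinuousOn.log ?_ ?_)) ?_
    · exact continuous_id.matrix_det.continuousOn
    · exact fun Θ hΘ ↦ (hKsub hΘ).1.det_pos.ne'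
    · refine Continuous.continuousOn ?_
      unfold frobInner
      fun_prop
  obtain ⟨Θ, hΘ, hmin⟩ := (isCompact_posSemidef_det_ge_trace_le (Real.exp (-c)) r).exists_isMinOn
    ⟨1, hsub 1 hone le_rfl⟩ hcont
  refine ⟨Θ, hKsub hΘ, fun A hA ↦ ?_⟩
  by_cases h : detObjective C A ≤ c
  · exact hmin (hsub A hA h)
  · exact le_trans (hmin (hsub 1 hone le_rfl)) (not_le.1 h).le

/-! ### Joining two uncorrelated vertices -/

/-- The change of the precision matrix caused by an edge `{a, b}` of covariance `t` between two
uncorrelated vertices of variances `p` and `q`: the inverse of the `2 × 2` covariance matrix minus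
the inverse of its diagonal part, placed in the rows and columns `a`, `b`. -/
noncomputable def edgeCorrection (a b : ι) (p q t : ℝ) : Matrix ι ι ℝ :=
  (t ^ 2 / (p * (p * q - t ^ 2))) • vecMulVec (Pi.single a 1) (Pi.single a 1) +
    (t ^ 2 / (q * (p * q - t ^ 2))) • vecMulVec (Pi.single b 1) (Pi.single b 1) +
    (-t / (p * q - t ^ 2)) • (vecMulVec (Pi.single a 1) (Pi.single b 1) +
      vecMulVec (Pi.single b 1) (Pi.single a 1))

/-- The covariance matrix obtained from `W` by joining `a` and `b`: correlations propagate through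
the new edge only. -/
noncomputable def joinCovariance (W : Matrix ι ι ℝ) (a b : ι) (p q t : ℝ) : Matrix ι ι ℝ :=
  W + (t / (p * q)) • (vecMulVec (W.col a) (W.row b) + vecMulVec (W.col b) (W.row a))

omit [Fintype ι] [DecidableEq ι] in
lemma joinCovariance_apply (W : Matrix ι ι ℝ) (a b : ι) (p q t : ℝ) (i j : ι) :
    joinCovariance W a b p q t i j =
      W i j + t / (p * q) * (W i a * W b j + W i b * W a j) := by
  simp [joinCovariance, vecMulVec_apply, mul_add]

lemma add_edgeCorrection_mul_joinCovariance {Θ W : Matrix ι ι ℝ} {a b : ι} {p q t : ℝ}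
    (hW : Θ * W = 1) (hp : 0 < p) (hq : 0 < q) (ht : t ^ 2 < p * q) (hab : W a b = 0)
    (hba : W b a = 0) (ha : W a a = p) (hb : W b b = q) :
    (Θ + edgeCorrection a b p q t) * joinCovariance W a b p q t = 1 := by
  have hΔ : p * q - t ^ 2 ≠ 0 := by linarith [sub_pos.2 ht]
  have hcol : ∀ c : ι, Θ *ᵥ W.col c = Pi.single c 1 := fun c ↦ by
    rw [← mulVec_single_one, mulVec_mulVec, hW, one_mulVec]
  have hrow : ∀ c : ι, (Pi.single c 1 : ι → ℝ) ᵥ* W = W.row c := fun c ↦ by simp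
  have hdot : ∀ c d : ι, (Pi.single c 1 : ι → ℝ) ⬝ᵥ W.col d = W c d := fun c d ↦ by simp
  have e : ∀ (x y u v : ι → ℝ), vecMulVec x y * vecMulVec u v = (y ⬝ᵥ u) • vecMulVec x v := by
    intro x y u v
    rw [vecMulVec_mul_vecMulVec, ← smul_vecMulVec]
    simp [vecMulVec_smul, smul_vecMulVec]
  have hexp : (Θ + edgeCorrection a b p q t) * joinCovariance W a b p q t = 1 +
      (t / (p * q)) • (vecMulVec (Pi.single a 1) (W.row b) + vecMulVec (Pi.single b 1) (W.row a)) +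
      edgeCorrection a b p q t * joinCovariance W a b p q t := by
    rw [add_mul, joinCovariance, mul_add, hW, Matrix.mul_smul, mul_add, mul_vecMulVec,
      mul_vecMulVec, hcol, hcol]
  rw [hexp, edgeCorrection, joinCovariance]
  simp only [add_mul, mul_add, Matrix.smul_mul, Matrix.mul_smul, vecMulVec_mul, e, hrow, hdot,
    hab, hba, ha, hb]
  ext i j
  simp only [Matrix.add_apply, Matrix.smul_apply, vecMulVec_apply, smul_eq_mul]
  have hp' := hp.ne'
  have hq' := hq.ne'
  field_simp
  ring

lemma posDef_joinCovariance {W : Matrix ι ι ℝ} {a b : ι} {p q t : ℝ}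
    (hW : W.PosDef) (hp : 0 < p) (hq : 0 < q) (ht : t ^ 2 < p * q) (hab : W a b = 0)
    (ha : W a a = p) (hb : W b b = q) :
    (joinCovariance W a b p q t).PosDef := by
  have hs : ∀ i j, W j i = W i j := fun i j ↦ by simpa using hW.isHermitian.apply i j
  refine .of_dotProduct_mulVec_pos ?_ fun x hx ↦ ?_
  · ext i j
    simp only [conjTranspose_apply, joinCovariance_apply, star_trivial]
    rw [hs i j, hs a j, hs b i, hs b j, hs a i]; ring
  · set u := (W *ᵥ x) a with hu
    set v := (W *ᵥ x) b with hv
    have hcol : ∀ c, x ⬝ᵥ W.col c = (W *ᵥ x) c := fun c ↦ by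
      simp only [dotProduct, mulVec, col_apply]
      exact Finset.sum_congr rfl fun i _ ↦ by rw [hs c i, mul_comm]
    have hrow : ∀ c, W.row c ⬝ᵥ x = (W *ᵥ x) c := fun c ↦ rfl
    have hform : x ⬝ᵥ (joinCovariance W a b p q t *ᵥ x) =
        x ⬝ᵥ (W *ᵥ x) + 2 * (t / (p * q)) * (u * v) := by
      simp only [joinCovariance, add_mulVec, smul_mulVec, vecMulVec_mulVec, dotProduct_add,
        dotProduct_smul, hrow, hcol, smul_eq_mul, op_smul_eq_smul]
      ring
    have hpos := hW.dotProduct_mulVec_pos hx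
    -- Bessel's inequality for the vectors `e_a`, `e_b`, orthogonal in the inner product of `W`.
    have hbessel : u ^ 2 / p + v ^ 2 / q ≤ x ⬝ᵥ (W *ᵥ x) := by
      have h := hW.posSemidef.dotProduct_mulVec_nonneg
        (x - (u / p) • Pi.single a 1 - (v / q) • Pi.single b 1)
      have hba : W b a = 0 := by rw [hs, hab]
      simp only [star_trivial, mulVec_sub, mulVec_smul, sub_dotProduct, dotProduct_sub,
        smul_dotProduct, dotProduct_smul, mulVec_single_one, single_dotProduct, smul_eq_mul,
        col_apply, one_mul, hcol, ha, hb, hab, hba, ← hu, ← hv, mul_zero, sub_zero] at h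
      have e1 : u / p * p = u := div_mul_cancel₀ u hp.ne'
      have e2 : v / q * q = v := div_mul_cancel₀ v hq.ne'
      rw [show u ^ 2 / p = u / p * u by ring, show v ^ 2 / q = v / q * v by ring]
      rw [e1, e2] at h
      linarith
    rw [star_trivial] at hpos ⊢
    rw [hform]
    by_cases h0 : u = 0 ∧ v = 0
    · rw [h0.1]; simpa using hpos
    · have hpq : 0 < p * q := mul_pos hp hq
      have hstrict : 0 < u ^ 2 / p + v ^ 2 / q + 2 * (t / (p * q)) * (u * v) := by
        have : u ^ 2 / p + v ^ 2 / q + 2 * (t / (p * q)) * (u * v) =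
            (q * u ^ 2 + p * v ^ 2 + 2 * t * u * v) / (p * q) := by
          field_simp
        rw [this]
        refine div_pos ?_ hpq
        have hsq : q * (q * u ^ 2 + p * v ^ 2 + 2 * t * u * v) =
            (q * u + t * v) ^ 2 + (p * q - t ^ 2) * v ^ 2 := by ring
        have hgt : 0 < (q * u + t * v) ^ 2 + (p * q - t ^ 2) * v ^ 2 := by
          by_cases hv0 : v = 0
          · have hu0 : u ≠ 0 := fun h ↦ h0 ⟨h, hv0⟩
            rw [hv0]
            have : 0 < (q * u) ^ 2 := by positivity
            simpa using this
          · have := sub_pos.2 ht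
            positivity
        rw [← hsq] at hgt
        exact pos_of_mul_pos_right hgt hq.le
      linarith

/-! ### Block matrices indexed by the connected components of a graph -/

section Blocks

variable {H : SimpleGraph V}

/-- The vertex set as the disjoint union of the connected components. -/
def sigmaSuppEquiv (H : SimpleGraph V) : V ≃ Σ k : H.ConnectedComponent, k.supp where
  toFun i := ⟨H.connectedComponentMk i, i, rfl⟩
  invFun s := s.2
  left_inv _ := rfl
  right_inv := by
    rintro ⟨k, i, hi⟩
    obtain rfl : H.connectedComponentMk i = k := hi
    rfl

/-- The matrix with the given blocks on the connected components of `H` and zeros elsewhere. -/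
noncomputable def componentBlocks (M : ∀ k : H.ConnectedComponent, Matrix k.supp k.supp ℝ) :
    Matrix V V ℝ :=
  open Classical in (blockDiagonal' M).submatrix (sigmaSuppEquiv H) (sigmaSuppEquiv H)

omit [Fintype V] [DecidableEq V] in
lemma componentBlocks_apply (M : ∀ k : H.ConnectedComponent, Matrix k.supp k.supp ℝ)
    (k : H.ConnectedComponent) (i j : k.supp) : componentBlocks M i j = M k i j := by
  classical
  have h : ∀ i : k.supp, sigmaSuppEquiv H i = ⟨k, i⟩ := fun i ↦
    (sigmaSuppEquiv H).eq_symm_apply.1 rfl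
  rw [componentBlocks, submatrix_apply, h, h, blockDiagonal'_apply_eq]

omit [Fintype V] [DecidableEq V] in
lemma componentBlocks_eq_zero (M : ∀ k : H.ConnectedComponent, Matrix k.supp k.supp ℝ) {i j : V}
    (h : ¬ H.Reachable i j) : componentBlocks M i j = 0 := by
  classical
  rw [componentBlocks, submatrix_apply]
  exact blockDiagonal'_apply_ne _ _ _ fun h' ↦ h (SimpleGraph.ConnectedComponent.exact h')

variable [∀ k : H.ConnectedComponent, Fintype k.supp]

omit [DecidableEq V] in
lemma componentBlocks_mul (M N : ∀ k : H.ConnectedComponent, Matrix k.supp k.supp ℝ) :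
    componentBlocks M * componentBlocks N = componentBlocks fun k ↦ M k * N k := by
  classical
  have : Fintype H.ConnectedComponent := Fintype.ofFinite _
  rw [componentBlocks, componentBlocks, submatrix_mul_equiv, ← blockDiagonal'_mul]
  rfl

omit [Fintype V] [∀ k : H.ConnectedComponent, Fintype k.supp] in
lemma componentBlocks_one [∀ k : H.ConnectedComponent, DecidableEq k.supp] :
    componentBlocks (fun k : H.ConnectedComponent ↦ (1 : Matrix k.supp k.supp ℝ)) = 1 := by
  ext i j
  by_cases h : H.Reachable i j
  · have hj : j ∈ (H.connectedComponentMk i).supp :=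
      (SimpleGraph.ConnectedComponent.sound h).symm
    rw [componentBlocks_apply _ (H.connectedComponentMk i) ⟨i, rfl⟩ ⟨j, hj⟩]
    rw [one_apply, one_apply]
    exact if_congr Subtype.mk_eq_mk rfl rfl
  · rw [componentBlocks_eq_zero _ h, one_apply_ne]
    rintro rfl
    exact h (SimpleGraph.Reachable.refl _)

lemma posDef_componentBlocks [∀ k : H.ConnectedComponent, DecidableEq k.supp]
    {M : ∀ k : H.ConnectedComponent, Matrix k.supp k.supp ℝ} (hM : ∀ k, (M k).PosDef) :
    (componentBlocks M).PosDef := by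
  choose R hR hMR using fun k ↦ exists_conjTranspose_mul_self_eq (hM k)
  have hunit : IsUnit (componentBlocks R) := by
    refine IsUnit.of_mul_eq_one (componentBlocks fun k ↦ (R k)⁻¹) ?_
    rw [componentBlocks_mul, ← componentBlocks_one (H := H)]
    congr 1
    funext k
    exact mul_nonsing_inv _ ((isUnit_iff_isUnit_det _).1 (hR k))
  have heq : componentBlocks M = (componentBlocks R)ᴴ * componentBlocks R := by
    have : (componentBlocks R)ᴴ = componentBlocks fun k ↦ (R k)ᴴ := by
      classical
      rw [componentBlocks, conjTranspose_submatrix, blockDiagonal'_conjTranspose]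
      rfl
    rw [this, componentBlocks_mul]
    congr 1
    funext k
    exact hMR k
  rw [heq]
  exact PosDef.conjTranspose_mul_self _ (mulVec_injective_of_isUnit hunit)

end Blocks

/-! ### Adding the bridges one by one -/

/-- `edgeCorrection` for an edge given as an unordered pair, with variances `p` and covariances `T`,
written entrywise. -/
noncomputable def bridgeCorrection (p : V → ℝ) (T : Matrix V V ℝ) (e : Sym2 V) : Matrix V V ℝ :=
  of fun i j ↦
    if i = j then ∑ m, if s(i, m) = e then T i m ^ 2 / (p i * (p i * p m - T i m ^ 2)) else 0
    else if s(i, j) = e then -T i j / (p i * p j - T i j ^ 2) else 0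

lemma bridgeCorrection_mk (p : V → ℝ) {T : Matrix V V ℝ} (hT : T.IsSymm) {a b : V} (hab : a ≠ b) :
    bridgeCorrection p T s(a, b) = edgeCorrection a b (p a) (p b) (T a b) := by
  have hTs : T b a = T a b := hT.apply a b
  ext i j
  simp only [bridgeCorrection, edgeCorrection, of_apply, Matrix.add_apply, Matrix.smul_apply,
    vecMulVec_apply, smul_eq_mul, Sym2.eq_iff, Pi.single_apply]
  by_cases hij : i = j
  · subst hij
    rw [if_pos rfl]
    by_cases hia : i = a
    · subst hia
      simp [hab]
    · by_cases hib : i = b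
      · subst hib
        simp [hab.symm, hTs, mul_comm (p a)]
      · simp [hia, hib]
  · rw [if_neg hij]
    by_cases hia : i = a
    · subst hia
      by_cases hjb : j = b
      · subst hjb; simp [hij, Ne.symm hij]
      · simp [hjb, Ne.symm hij, hab]
    · by_cases hib : i = b
      · subst hib
        by_cases hja : j = a
        · subst hja; simp [hij, Ne.symm hij, hTs, mul_comm (p i)]
        · simp [hja, hia, Ne.symm hij]
      · simp [hia, hib]

/-- The graph in which, of all the bridges of `G`, only those in `F` are kept. -/
def keepBridges (G : SimpleGraph V) (F : Finset (Sym2 V)) : SimpleGraph V :=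
  G.deleteEdges {e | (e ∈ G.edgeSet ∧ G.IsBridge e) ∧ e ∉ F}

omit [Fintype V] [DecidableEq V] in
lemma keepBridges_mono (G : SimpleGraph V) {F F' : Finset (Sym2 V)} (h : F ⊆ F') :
    keepBridges G F ≤ keepBridges G F' :=
  SimpleGraph.deleteEdges_anti fun _ he ↦ ⟨he.1, fun hF ↦ he.2 (h hF)⟩

/-- The covariance matrix after adding a set `F` of bridges to uncorrelated blocks. The block
covariances and the variances do not change, the covariance along a bridge in `F` is prescribed by
`T`, and vertices that are not connected through `F` remain uncorrelated. -/
lemma exists_covariance_of_bridges {G : SimpleGraph V} {p : V → ℝ} {T Θ₀ W₀ : Matrix V V ℝ}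
    (hp : ∀ i, 0 < p i) (hT : T.IsSymm) (hT0 : ∀ i j, 0 ≤ T i j)
    (hTp : ∀ i j, i ≠ j → T i j ^ 2 < p i * p j)
    (hpd : W₀.PosDef) (hmul : Θ₀ * W₀ = 1) (hnonneg : ∀ i j, 0 ≤ W₀ i j)
    (hdiag : ∀ i, W₀ i i = p i)
    (hzero : ∀ i j, ¬ (keepBridges G ∅).Reachable i j → W₀ i j = 0) (F : Finset (Sym2 V))
    (hF : ∀ e ∈ F, e ∈ G.edgeSet ∧ G.IsBridge e) :
    ∃ W : Matrix V V ℝ, W.PosDef ∧ (Θ₀ + ∑ e ∈ F, bridgeCorrection p T e) * W = 1 ∧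
      (∀ i j, 0 ≤ W i j) ∧ (∀ i j, ¬ (keepBridges G F).Reachable i j → W i j = 0) ∧
      (∀ i j, (keepBridges G ∅).Reachable i j → W i j = W₀ i j) ∧
      ∀ i j, s(i, j) ∈ F → W i j = T i j := by
  induction F using Finset.induction_on with
  | empty => exact ⟨W₀, hpd, by simpa using hmul, hnonneg, hzero, fun _ _ _ ↦ rfl, by simp⟩
  | insert e F he ih =>
    obtain ⟨W, h1, h2, h3, h4, h5, h6⟩ := ih fun e he ↦ hF e (Finset.mem_insert_of_mem he)
    induction e with | _ a b
    obtain ⟨hadj, hbr⟩ := hF _ (Finset.mem_insert_self _ _)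
    rw [SimpleGraph.mem_edgeSet] at hadj
    have hne : a ≠ b := hadj.ne
    have hmono := keepBridges_mono G (Finset.subset_insert s(a, b) F)
    have hnr : ¬ (keepBridges G F).Reachable a b := fun h ↦
      SimpleGraph.isBridge_iff.1 hbr (h.mono (SimpleGraph.deleteEdges_anti (by
        rintro _ rfl
        exact ⟨⟨hadj, hbr⟩, he⟩)))
    have hadj' : (keepBridges G (insert s(a, b) F)).Adj a b := by
      rw [keepBridges, SimpleGraph.deleteEdges_adj]
      exact ⟨hadj, fun h ↦ h.2 (Finset.mem_insert_self _ _)⟩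
    have hab : W a b = 0 := h4 a b hnr
    have hba : W b a = 0 := h4 b a fun h ↦ hnr h.symm
    have hvar : ∀ i, W i i = p i := fun i ↦ by
      rw [h5 i i (SimpleGraph.Reachable.refl _), hdiag]
    have hreach : ∀ {i j}, W i j ≠ 0 → (keepBridges G F).Reachable i j := fun h ↦ by
      by_contra hn
      exact h (h4 _ _ hn)
    -- The new edge is a bridge, hence covariances between already connected vertices are unchanged.
    have hkeep : ∀ i j, (keepBridges G F).Reachable i j →
        joinCovariance W a b (p a) (p b) (T a b) i j = W i j := fun i j hij ↦ by
      have e1 : W i a * W b j = 0 := by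
        by_contra hn
        exact hnr ((hreach (left_ne_zero_of_mul hn)).symm.trans
          (hij.trans (hreach (right_ne_zero_of_mul hn)).symm))
      have e2 : W i b * W a j = 0 := by
        by_contra hn
        exact hnr ((hreach (right_ne_zero_of_mul hn)).trans
          (hij.symm.trans (hreach (left_ne_zero_of_mul hn))))
      rw [joinCovariance_apply, e1, e2, add_zero, mul_zero, add_zero]
    have hpab : 0 < p a * p b := mul_pos (hp a) (hp b)
    have hTba : T b a = T a b := hT.apply a b
    refine ⟨joinCovariance W a b (p a) (p b) (T a b),
      posDef_joinCovariance h1 (hp a) (hp b) (hTp a b hne) hab (hvar a) (hvar b), ?_,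
      fun i j ↦ ?_, fun i j hij ↦ ?_, fun i j hij ↦ ?_, fun i j hij ↦ ?_⟩
    · rw [Finset.sum_insert he, add_comm (bridgeCorrection _ _ _), ← add_assoc,
        bridgeCorrection_mk p hT hne]
      exact add_edgeCorrection_mul_joinCovariance h2 (hp a) (hp b) (hTp a b hne) hab hba
        (hvar a) (hvar b)
    · rw [joinCovariance_apply]
      exact add_nonneg (h3 i j) (mul_nonneg (div_nonneg (hT0 a b) hpab.le)
        (add_nonneg (mul_nonneg (h3 _ _) (h3 _ _)) (mul_nonneg (h3 _ _) (h3 _ _))))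
    · have e0 : W i j = 0 := h4 i j fun h ↦ hij (h.mono hmono)
      have e1 : W i a * W b j = 0 := by
        by_contra hn
        exact hij (((hreach (left_ne_zero_of_mul hn)).mono hmono).trans
          (hadj'.reachable.trans ((hreach (right_ne_zero_of_mul hn)).mono hmono)))
      have e2 : W i b * W a j = 0 := by
        by_contra hn
        exact hij (((hreach (left_ne_zero_of_mul hn)).mono hmono).trans
          (hadj'.symm.reachable.trans ((hreach (right_ne_zero_of_mul hn)).mono hmono)))
      rw [joinCovariance_apply, e0, e1, e2, add_zero, mul_zero, add_zero]
    · rw [hkeep i j (hij.mono (keepBridges_mono G (Finset.empty_subset F))), h5 i j hij]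
    · rcases Finset.mem_insert.1 hij with hij | hij
      · have hpa := (hp a).ne'
        have hpb := (hp b).ne'
        rcases Sym2.eq_iff.1 hij with ⟨rfl, rfl⟩ | ⟨rfl, rfl⟩
        · rw [joinCovariance_apply, hab, hvar, hvar]
          field_simp
          ring
        · rw [joinCovariance_apply, hba, hvar, hvar, hTba]
          field_simp
          ring
      · have hkeepadj : (keepBridges G F).Adj i j := by
          rw [keepBridges, SimpleGraph.deleteEdges_adj]
          exact ⟨(hF _ (Finset.mem_insert_of_mem hij)).1, fun h ↦ h.2 hij⟩
        rw [hkeep i j hkeepadj.reachable, h6 i j hij]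

/-! ### The penalized problem and its sub-problems -/

/-- On M-matrices the penalty is linear, because off-diagonal entries are nonpositive. -/
lemma glassoObjective_eq_detObjective (S : Matrix V V ℝ) {Λ Θ : Matrix V V ℝ}
    (hΛ : ∀ i, Λ i i = 0) (hΘ : Θ ∈ MMatrices V) :
    glassoObjective S Λ Θ = detObjective (S - Λ) Θ := by
  simp only [glassoObjective, detObjective, frobInner, add_assoc, ← Finset.sum_add_distrib]
  congr 1
  refine Finset.sum_congr rfl fun i _ ↦ Finset.sum_congr rfl fun j _ ↦ ?_
  rw [Matrix.sub_apply]
  split_ifs with hij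
  · rw [abs_of_nonpos (hΘ.2 i j hij)]; ring
  · rw [not_not] at hij; subst hij; rw [hΛ]; ring

lemma isOptimal_iff (S : Matrix V V ℝ) {Λ : Matrix V V ℝ} (hΛ : ∀ i, Λ i i = 0)
    (Θ : Matrix V V ℝ) :
    IsOptimal S Λ Θ ↔ Θ ∈ MMatrices V ∧ IsMinOn (detObjective (S - Λ)) (MMatrices V) Θ := by
  refine and_congr_right fun hΘ ↦ ?_
  simp only [isMinOn_iff]
  refine forall₂_congr fun A hA ↦ ?_
  rw [glassoObjective_eq_detObjective S hΛ hA, glassoObjective_eq_detObjective S hΛ hΘ]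

omit [DecidableEq V] in
/-- Optimality in a sub-problem, for any choice of the finiteness and decidability instances. -/
lemma isSubOptimal_iff (S Λ : Matrix V V ℝ) (U : Set V) [hf : Fintype U] [hd : DecidableEq U]
    (Θ : Matrix U U ℝ) :
    IsSubOptimal S Λ U Θ ↔ Θ ∈ MMatrices U ∧
      IsMinOn (detObjective ((S - Λ).submatrix Subtype.val Subtype.val)) (MMatrices U) Θ := by
  classical
  obtain rfl : hf = Subtype.fintype (· ∈ U) := Subsingleton.elim _ _
  obtain rfl : hd = Subtype.instDecidableEq := Subsingleton.elim _ _
  exact Iff.rfl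

omit [DecidableEq V] in
/-- Every sub-problem, on an arbitrary vertex set, has a unique minimizer. -/
lemma existsUnique_isSubOptimal {S Λ : Matrix V V ℝ} (hC : (S - Λ).IsSymm)
    (hpos : ∀ i, 0 < (S - Λ) i i)
    (hlt : ∀ i j, i ≠ j → (S - Λ) i j < √((S - Λ) i i * (S - Λ) j j)) (U : Set V) :
    ∃! Θ : Matrix U U ℝ, IsSubOptimal S Λ U Θ := by
  classical
  obtain ⟨Θ, hΘ, hmin⟩ := exists_isMinOn_detObjective
    (C := (S - Λ).submatrix (Subtype.val : U → V) Subtype.val) (fun i ↦ hpos i)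
    fun i j hij ↦ hlt i j (Subtype.val_injective.ne hij)
  refine ⟨Θ, (isSubOptimal_iff S Λ U Θ).2 ⟨hΘ, hmin⟩, fun A hA ↦ ?_⟩
  have hA := (isSubOptimal_iff S Λ U A).1 hA
  exact ((isKKT_of_isMinOn (hC.submatrix _) hΘ hmin).isMinOn hΘ).2 A hA.1 hA.2

/-! ### The thresholded matrix and its bridges -/

omit [Fintype V] in
lemma thresholdedGraph_adj {S Λ : Matrix V V ℝ} (hS : S.IsSymm) (hΛ : Λ.IsSymm) (i j : V) :
    (thresholdedGraph S Λ).Adj i j ↔ i ≠ j ∧ Λ i j < S i j := by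
  have h1 : S j i = S i j := hS.apply i j
  have h2 : Λ j i = Λ i j := hΛ.apply i j
  simp only [thresholdedGraph, suppGraph, SimpleGraph.fromRel_adj, thresholded, of_apply, h1, h2]
  constructor
  · rintro ⟨hij, h⟩
    refine ⟨hij, ?_⟩
    by_contra hn
    simp [hn] at h
  · rintro ⟨hij, h⟩
    refine ⟨hij, Or.inl ?_⟩
    rw [if_pos ⟨hij, h⟩]
    exact (sub_pos.2 h).ne'

omit [Fintype V] in
lemma thresholded_isSymm {S Λ : Matrix V V ℝ} (hS : S.IsSymm) (hΛ : Λ.IsSymm) :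
    (thresholded S Λ).IsSymm := by
  ext i j
  simp only [transpose_apply, thresholded, of_apply, hS.apply i j, hΛ.apply i j, ne_comm]

omit [Fintype V] in
lemma thresholded_nonneg (S Λ : Matrix V V ℝ) (i j : V) : 0 ≤ thresholded S Λ i j := by
  simp only [thresholded, of_apply]
  split_ifs with h
  · exact (sub_pos.2 h.2).le
  · exact le_rfl

omit [Fintype V] in
lemma thresholded_sq_lt {S Λ : Matrix V V ℝ} (hSpos : ∀ i, 0 < S i i)
    (hΛnonneg : ∀ i j, 0 ≤ Λ i j) (hST : ∀ i j, i ≠ j → S i j < √(S i i * S j j)) {i j : V}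
    (hij : i ≠ j) : thresholded S Λ i j ^ 2 < S i i * S j j := by
  have hpos := mul_pos (hSpos i) (hSpos j)
  rw [← Real.lt_sqrt (thresholded_nonneg S Λ i j)]
  simp only [thresholded, of_apply]
  split_ifs
  · linarith [hΛnonneg i j, hST i j hij]
  · exact Real.sqrt_pos.2 hpos

open Classical in
/-- The finite set of bridges of the thresholded graph. -/
noncomputable def bridgeFinset (S Λ : Matrix V V ℝ) : Finset (Sym2 V) :=
  {e | e ∈ (thresholdedGraph S Λ).edgeSet ∧ (thresholdedGraph S Λ).IsBridge e}

lemma mk_mem_bridgeFinset {S Λ : Matrix V V ℝ} {i j : V} :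
    s(i, j) ∈ bridgeFinset S Λ ↔ Bridge S Λ i j := by
  simp [bridgeFinset, Bridge]

lemma sum_bridgeCorrection_diag (S Λ : Matrix V V ℝ) (i : V) :
    (∑ e ∈ bridgeFinset S Λ, bridgeCorrection (fun i ↦ S i i) (thresholded S Λ) e) i i =
      zeta S Λ i := by
  classical
  rw [Matrix.sum_apply]
  simp only [bridgeCorrection, of_apply, if_true]
  rw [Finset.sum_comm, zeta, Finset.sum_filter, Finset.mul_sum]
  refine Finset.sum_congr rfl fun m _ ↦ ?_
  rw [Finset.sum_ite_eq]
  simp only [mk_mem_bridgeFinset]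
  split_ifs
  · rw [div_mul_div_comm, one_mul]
  · rw [mul_zero]

open Classical in
lemma sum_bridgeCorrection_of_ne (S Λ : Matrix V V ℝ) {i j : V} (hij : i ≠ j) :
    (∑ e ∈ bridgeFinset S Λ, bridgeCorrection (fun i ↦ S i i) (thresholded S Λ) e) i j =
      if Bridge S Λ i j then
        -thresholded S Λ i j / (S i i * S j j - thresholded S Λ i j ^ 2) else 0 := by
  rw [Matrix.sum_apply]
  simp only [bridgeCorrection, of_apply, if_neg hij]
  rw [Finset.sum_ite_eq]
  simp only [mk_mem_bridgeFinset]

omit [Fintype V] [DecidableEq V] in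
lemma keepBridges_empty (G : SimpleGraph V) :
    keepBridges G ∅ = G.deleteEdges {e | e ∈ G.edgeSet ∧ G.IsBridge e} := by
  simp [keepBridges]

end MTP2

open MTP2 Matrix in
theorem theorem1 {V : Type*} [Fintype V] [DecidableEq V] (S Λ : Matrix V V ℝ)
    (hS : S.IsSymm) (hSpos : ∀ i, 0 < S i i)
    (hΛ : Λ.IsSymm) (hΛnonneg : ∀ i j, 0 ≤ Λ i j) (hΛdiag : ∀ i, Λ i i = 0)
    (hST : ∀ i j, i ≠ j → S i j < √(S i i * S j j)) :
    (∀ k : MTP2.Cluster (MTP2.thresholdedGraph S Λ),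
      ∃! Θk : Matrix k.supp k.supp ℝ, MTP2.IsSubOptimal S Λ k.supp Θk) ∧
    ∀ Θhat : (k : MTP2.Cluster (MTP2.thresholdedGraph S Λ)) → Matrix k.supp k.supp ℝ,
      (∀ k, MTP2.IsSubOptimal S Λ k.supp (Θhat k)) →
      ∃ Θstar : Matrix V V ℝ,
        MTP2.IsOptimal S Λ Θstar ∧
        (∀ Θ, MTP2.IsOptimal S Λ Θ → Θ = Θstar) ∧
        (∀ k, ∀ i : k.supp, Θstar i i = Θhat k i i + MTP2.zeta S Λ i) ∧
        (∀ k, ∀ i j : k.supp, i ≠ j → Θstar i j = Θhat k i j) ∧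
        (∀ i j, MTP2.Bridge S Λ i j →
          Θstar i j = -MTP2.thresholded S Λ i j /
            (S i i * S j j - MTP2.thresholded S Λ i j ^ 2)) ∧
        (∀ i j, (¬ ∃ k : MTP2.Cluster (MTP2.thresholdedGraph S Λ), i ∈ k.supp ∧ j ∈ k.supp) →
          ¬ MTP2.Bridge S Λ i j → Θstar i j = 0) := by
  classical
  have hCsymm : (S - Λ).IsSymm := hS.sub hΛ
  have hCdiag : ∀ i, (S - Λ) i i = S i i := fun i ↦ by rw [Matrix.sub_apply, hΛdiag, sub_zero]
  have hClt : ∀ i j, i ≠ j → (S - Λ) i j < √((S - Λ) i i * (S - Λ) j j) := fun i j hij ↦ by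
    rw [hCdiag, hCdiag, Matrix.sub_apply]
    linarith [hΛnonneg i j, hST i j hij]
  refine ⟨fun k ↦ existsUnique_isSubOptimal hCsymm (fun i ↦ by rw [hCdiag]; exact hSpos i) hClt _,
    ?_⟩
  set G := thresholdedGraph S Λ with hG
  set H := G.deleteEdges {e | e ∈ G.edgeSet ∧ G.IsBridge e} with hH
  set T := thresholded S Λ with hT
  intro Θhat hΘhat
  have hM : ∀ k, Θhat k ∈ MMatrices k.supp := fun k ↦ ((isSubOptimal_iff _ _ _ _).1 (hΘhat k)).1
  have hK : ∀ k : H.ConnectedComponent,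
      IsKKT ((S - Λ).submatrix (Subtype.val : k.supp → V) Subtype.val) (Θhat k) (Θhat k)⁻¹ :=
    fun k ↦ isKKT_of_isMinOn (hCsymm.submatrix _) (hM k)
      ((isSubOptimal_iff _ _ _ _).1 (hΘhat k)).2
  set Θ₀ : Matrix V V ℝ := componentBlocks Θhat with hΘ₀
  set W₀ : Matrix V V ℝ := componentBlocks fun k ↦ (Θhat k)⁻¹ with hW₀
  -- Two vertices of the same cluster, in the form in which block entries can be evaluated.
  have hcluster : ∀ {P : V → V → Prop},
      (∀ (k : H.ConnectedComponent) (i j : k.supp), P i j) → ∀ i j, H.Reachable i j → P i j :=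
    fun h i j hij ↦ h (H.connectedComponentMk i) ⟨i, rfl⟩
      ⟨j, (SimpleGraph.ConnectedComponent.sound hij).symm⟩
  have hreach : ∀ (k : H.ConnectedComponent) (i j : k.supp), H.Reachable i j := fun k i j ↦
    SimpleGraph.ConnectedComponent.exact (Eq.trans i.2 (Eq.symm j.2))
  have hbridge : ∀ i j, Bridge S Λ i j → ¬ H.Reachable i j := fun i j hb h ↦
    SimpleGraph.isBridge_iff.1 hb.2 (h.mono (SimpleGraph.deleteEdges_anti (by
      rintro _ rfl
      exact ⟨hb.1, hb.2⟩)))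
  obtain ⟨W, hWpd, hmul, hnonneg, -, hblock, hWbridge⟩ :=
    exists_covariance_of_bridges (G := G) (p := fun i ↦ S i i) (T := T) (Θ₀ := Θ₀) (W₀ := W₀)
      hSpos (thresholded_isSymm hS hΛ) (thresholded_nonneg S Λ)
      (fun i j hij ↦ thresholded_sq_lt hSpos hΛnonneg hST hij)
      (posDef_componentBlocks fun k ↦ (hM k).1.inv)
      (by
        rw [hΘ₀, hW₀, componentBlocks_mul, ← componentBlocks_one (H := H)]
        congr 1
        funext k
        exact (hK k).mul_eq_one)
      (fun i j ↦ by
        by_cases h : H.Reachable i j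
        · refine hcluster (P := fun i j ↦ 0 ≤ W₀ i j) (fun k i j ↦ ?_) i j h
          rw [hW₀, componentBlocks_apply]
          exact inv_nonneg_of_mem_MMatrices (hM k) (hK k).mul_eq_one i j
        · rw [hW₀, componentBlocks_eq_zero _ h])
      (fun i ↦ by
        have h := (hK (H.connectedComponentMk i)).diag_eq ⟨i, rfl⟩
        rw [← componentBlocks_apply (fun k ↦ (Θhat k)⁻¹)] at h
        exact h.trans (hCdiag i))
      (fun i j h ↦ by
        rw [keepBridges_empty] at h
        exact componentBlocks_eq_zero _ h)
      (bridgeFinset S Λ) (fun e he ↦ by simpa [bridgeFinset] using he)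
  rw [keepBridges_empty] at hblock
  set Θs := Θ₀ + ∑ e ∈ bridgeFinset S Λ, bridgeCorrection (fun i ↦ S i i) T e with hΘs
  have hdiag : ∀ (k : H.ConnectedComponent) (i : k.supp),
      Θs i i = Θhat k i i + zeta S Λ i := fun k i ↦ by
    rw [hΘs, Matrix.add_apply, sum_bridgeCorrection_diag, hΘ₀, componentBlocks_apply]
  have hoff : ∀ i j, i ≠ j → Θs i j =
      Θ₀ i j + if Bridge S Λ i j then -T i j / (S i i * S j j - T i j ^ 2) else 0 :=
    fun i j hij ↦ by rw [hΘs, Matrix.add_apply, sum_bridgeCorrection_of_ne S Λ hij]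
  have hin : ∀ (k : H.ConnectedComponent) (i j : k.supp), i ≠ j → Θs i j = Θhat k i j :=
    fun k i j hij ↦ by
      rw [hoff i j (Subtype.val_injective.ne hij), if_neg fun h ↦ hbridge _ _ h (hreach k i j),
        add_zero, hΘ₀, componentBlocks_apply]
  have hon : ∀ i j, Bridge S Λ i j → Θs i j = -T i j / (S i i * S j j - T i j ^ 2) :=
    fun i j hb ↦ by
      rw [hoff i j hb.1.ne, if_pos hb, hΘ₀, componentBlocks_eq_zero _ (hbridge i j hb), zero_add]
  have hout : ∀ i j, ¬ H.Reachable i j → ¬ Bridge S Λ i j → Θs i j = 0 := fun i j h hb ↦ by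
    have hij : i ≠ j := by
      rintro rfl
      exact h (SimpleGraph.Reachable.refl _)
    rw [hoff i j hij, if_neg hb, hΘ₀, componentBlocks_eq_zero _ h, zero_add]
  have hWin : ∀ (k : H.ConnectedComponent) (i j : k.supp), W i j = (Θhat k)⁻¹ i j :=
    fun k i j ↦ by
      rw [hblock i j (hreach k i j), hW₀, componentBlocks_apply (fun k ↦ (Θhat k)⁻¹)]
  have hWon : ∀ i j, Bridge S Λ i j → W i j = (S - Λ) i j := fun i j hb ↦ by
    rw [hWbridge i j (mk_mem_bridgeFinset.2 hb), hT, thresholded, of_apply,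
      if_pos ((thresholdedGraph_adj hS hΛ i j).1 hb.1), Matrix.sub_apply]
  have hmem : Θs ∈ MMatrices V := by
    refine ⟨?_, fun i j hij ↦ ?_⟩
    · rw [← inv_eq_left_inv hmul]
      exact hWpd.inv
    · by_cases h : H.Reachable i j
      · refine hcluster (P := fun i j ↦ i ≠ j → Θs i j ≤ 0) (fun k i j hij ↦ ?_) i j h hij
        have hij' : i ≠ j := fun h ↦ hij (congrArg _ h)
        rw [hin k i j hij']
        exact (hM k).2 i j hij'
      · by_cases hb : Bridge S Λ i j
        · rw [hon i j hb]
          exact div_nonpos_of_nonpos_of_nonneg (neg_nonpos.2 (thresholded_nonneg S Λ i j))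
            (sub_pos.2 (thresholded_sq_lt hSpos hΛnonneg hST hij)).le
        · exact (hout i j h hb).le
  have hkkt : IsKKT (S - Λ) Θs W := by
    refine ⟨hmul, fun i ↦ ?_, fun i j hij ↦ ?_, fun i j hij h0 ↦ ?_⟩
    · rw [hWin (H.connectedComponentMk i) ⟨i, rfl⟩ ⟨i, rfl⟩]
      exact (hK (H.connectedComponentMk i)).diag_eq ⟨i, rfl⟩
    · by_cases h : H.Reachable i j
      · refine hcluster (P := fun i j ↦ i ≠ j → (S - Λ) i j ≤ W i j) (fun k i j hij ↦ ?_) i j h hij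
        rw [hWin k i j]
        exact (hK k).le i j fun h ↦ hij (congrArg _ h)
      · by_cases hb : Bridge S Λ i j
        · exact (hWon i j hb).ge
        · -- A pair in different clusters that is not a bridge is not an edge, so its entry of
          -- `S - Λ` is nonpositive.
          refine le_trans ?_ (hnonneg i j)
          rw [Matrix.sub_apply, sub_nonpos]
          by_contra hlt
          have hadj : G.Adj i j := (thresholdedGraph_adj hS hΛ i j).2 ⟨hij, not_le.1 hlt⟩
          refine h (SimpleGraph.Adj.reachable ?_)
          rw [hH, SimpleGraph.deleteEdges_adj]
          exact ⟨hadj, fun he ↦ hb ⟨hadj, he.2⟩⟩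
    · by_cases h : H.Reachable i j
      · refine hcluster (P := fun i j ↦ i ≠ j → Θs i j ≠ 0 → W i j = (S - Λ) i j)
          (fun k i j hij h0 ↦ ?_) i j h hij h0
        have hij' : i ≠ j := fun h ↦ hij (congrArg _ h)
        rw [hin k i j hij'] at h0
        rw [hWin k i j]
        exact (hK k).eq_of_ne_zero i j hij' h0
      · by_cases hb : Bridge S Λ i j
        · exact hWon i j hb
        · exact absurd (hout i j h hb) h0
  obtain ⟨hmin, huniq⟩ := hkkt.isMinOn hmem
  refine ⟨Θs, (isOptimal_iff S hΛdiag _).2 ⟨hmem, hmin⟩, fun Θ hΘ ↦ ?_, hdiag, hin, hon,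
    fun i j hk hb ↦ hout i j (fun h ↦ hk ?_) hb⟩
  · have := (isOptimal_iff S hΛdiag _).1 hΘ
    exact huniq Θ this.1 this.2
  · exact ⟨H.connectedComponentMk i, rfl, (SimpleGraph.ConnectedComponent.sound h).symm⟩
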